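/- Let $q\ge 3$ be an integer, $\lambda_q=2\cos(\pi/q)$, and let $\Gamma_q\le \mathrm{PSL}_2(\mathbb R)$ be the Hecke triangle group generated by $S=\begin{bmatrix}0&1\\-1&0\end{bmatrix}$ and $T_q=\begin{bmatrix}1&\lambda_q\\0&1\end{bmatrix}$. A projective oriented quadratic form $[A,B,C,s]$ consists of an indefinite real binary quadratic form $f=Ax^2+Bxy+Cy^2$ of discriminant $\Delta=B^2-4AC>0$ together with a sign $s\in\{\pm1\}$, where $[A,B,C,s]$ and $[-A,-B,-C,-s]$ are identified. It is a $\Gamma_q$-form if the associated element $$\begin{bmatrix}\frac{-B+s\sqrt{\Delta+4}}{2}&-C\\ A&\frac{B+s\sqrt{\Delta+4}}{2}\end{bmatrix}\in\mathrm{PSL}_2(\mathbb R)$$ is a hyperbolic element of $\Gamma_q$. For $A\neq0$ let $x_\pm=\frac{-B\pm\sqrt{\Delta}}{2A}$; for $A=0$ let $x_+=-C/B$, $x_-=\infty$ if $B>0$, and $x_+=\infty$, $x_-=-C/B$ if $B<0$. The attracting and repelling zeros of $[A,B,C,s]$ are $(x_a,x_r)=(x_+,x_-)$ if $s=+1$ and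 $(x_a,x_r)=(x_-,x_+)$ if $s=-1$. The form is called reduced if $x_a>0>x_r$, where $r<\infty$ for all $r\in\mathbb R$. Theorem. For every integer $q\ge3$ and every real $D>0$ there are only finitely many reduced $\Gamma_q$-forms of discriminant at most $D$. -/

import Mathlib

open scoped MatrixGroups

noncomputable section

namespace HeckeForms

/-- An indefinite binary quadratic form `[a, b, c] = a x² + b x y + c y²` with real coefficients:
its discriminant `b² - 4 a c` is positive. -/
@[ext]
structure QF where
  a : ℝ
  b : ℝ
  c : ℝ
  discr_pos : 0 < b ^ 2 - 4 * a * c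

namespace QF

/-- The discriminant `b² - 4 a c`. -/
def discr (f : QF) : ℝ := f.b ^ 2 - 4 * f.a * f.c

/-- The form `-f = [-a, -b, -c]`. -/
instance : Neg QF :=
  ⟨fun f => ⟨-f.a, -f.b, -f.c, by have := f.discr_pos; nlinarith⟩⟩

theorem neg_a (f : QF) : (-f).a = -f.a := rfl

theorem neg_b (f : QF) : (-f).b = -f.b := rfl

theorem neg_c (f : QF) : (-f).c = -f.c := rfl

theorem neg_neg (f : QF) : - -f = f := by
  ext <;> simp [neg_a, neg_b, neg_c]

theorem discr_neg (f : QF) : (-f).discr = f.discr := by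
  simp [discr, neg_a, neg_b, neg_c]

/-- If `a = 0` then `b ≠ 0`, since `b² = b² - 4 a c` is positive. -/
theorem b_ne_zero_of_a_eq_zero (f : QF) (h : f.a = 0) : f.b ≠ 0 := by
  intro hb
  have := f.discr_pos
  simp [h, hb] at this

/-- The zero `x₊` of a form, in `P¹(ℝ) = ℝ ∪ {∞}`, ordered by `r < ∞` for real `r`.
For `a ≠ 0` it is `(-b + √D) / (2 a)`. For `a = 0` the zeros are `-c / b` and `∞`, and `x₊` is the
one that makes it the limit of `(-b + √D) / (2 a)` as `a → 0`: the finite one iff `b > 0`. -/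
def zeroPlus (f : QF) : WithTop ℝ :=
  if f.a = 0 then (if 0 < f.b then (((-f.c / f.b : ℝ)) : WithTop ℝ) else ⊤)
  else (((-f.b + √f.discr) / (2 * f.a) : ℝ) : WithTop ℝ)

/-- The zero `x₋` of a form, in `P¹(ℝ) = ℝ ∪ {∞}`.
For `a ≠ 0` it is `(-b - √D) / (2 a)`; for `a = 0` it is the zero different from `x₊`. -/
def zeroMinus (f : QF) : WithTop ℝ :=
  if f.a = 0 then (if 0 < f.b then ⊤ else (((-f.c / f.b : ℝ)) : WithTop ℝ))
  else (((-f.b - √f.discr) / (2 * f.a) : ℝ) : WithTop ℝ)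

theorem zeroPlus_neg (f : QF) : (-f).zeroPlus = f.zeroMinus := by
  unfold zeroPlus zeroMinus
  rw [discr_neg, neg_a, neg_b, neg_c]
  by_cases ha : f.a = 0
  · have hb := f.b_ne_zero_of_a_eq_zero ha
    rcases lt_or_gt_of_ne hb with h | h
    · have h' : ¬ 0 < f.b := not_lt.mpr h.le
      have e : - -f.c / -f.b = -f.c / f.b := by rw [neg_div_neg_eq]
      simp only [ha, neg_zero, if_true, h', if_false, neg_pos, h, e]
    · have h' : ¬ f.b < 0 := not_lt.mpr h.le
      simp [ha, h, h']
  · simp only [neg_eq_zero, ha, if_false]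
    congr 1
    field_simp
    ring

theorem zeroMinus_neg (f : QF) : (-f).zeroMinus = f.zeroPlus := by
  rw [← zeroPlus_neg, neg_neg]

end QF

/-- Oriented quadratic forms: a form together with an orientation `s ∈ {1, -1}`. -/
abbrev OQF : Type := QF × ℤˣ

namespace OQF

/-- The attracting zero of `(f, s)`: it is `x₊(f)` if `s = 1` and `x₋(f)` if `s = -1`. -/
def attractingZero (F : OQF) : WithTop ℝ := if F.2 = 1 then F.1.zeroPlus else F.1.zeroMinus

/-- The repelling zero of `(f, s)`: it is `x₋(f)` if `s = 1` and `x₊(f)` if `s = -1`. -/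
def repellingZero (F : OQF) : WithTop ℝ := if F.2 = 1 then F.1.zeroMinus else F.1.zeroPlus

/-- The unimodular matrix attached to an oriented form `([a, b, c], s)` of discriminant `D`:
`((-b + s √(D + 4)) / 2, -c; a, (b + s √(D + 4)) / 2)`. -/
def toSL (F : OQF) : SL(2, ℝ) :=
  ⟨!![(-F.1.b + ((F.2 : ℤ) : ℝ) * √(F.1.discr + 4)) / 2, -F.1.c;
      F.1.a, (F.1.b + ((F.2 : ℤ) : ℝ) * √(F.1.discr + 4)) / 2], by
    have h0 : 0 ≤ F.1.discr + 4 := by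
      have := F.1.discr_pos
      unfold QF.discr
      linarith
    have h1 := Real.mul_self_sqrt h0
    have h2 : ((F.2 : ℤ) : ℝ) * ((F.2 : ℤ) : ℝ) = 1 := by
      rcases Int.units_eq_one_or F.2 with h | h <;> simp [h]
    have h3 : F.1.discr = F.1.b ^ 2 - 4 * F.1.a * F.1.c := rfl
    rw [Matrix.det_fin_two_of]
    generalize √(F.1.discr + 4) = r at *
    generalize ((F.2 : ℤ) : ℝ) = s at *
    linear_combination (1 / 4) * s * s * h1 + (1 / 4) * (F.1.discr + 4) * h2 + (1 / 4) * h3⟩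

/-- `(f, s)` and `(-f, -s)` are identified. -/
instance setoid : Setoid OQF where
  r F G := F = G ∨ F = (-G.1, -G.2)
  iseqv :=
    { refl := fun _ => Or.inl rfl
      symm := by
        rintro F G (rfl | rfl)
        · exact Or.inl rfl
        · exact Or.inr (by simp [QF.neg_neg])
      trans := by
        rintro F G H (rfl | rfl) (rfl | rfl)
        · exact Or.inl rfl
        · exact Or.inr rfl
        · exact Or.inr rfl
        · exact Or.inl (by simp [QF.neg_neg]) }

theorem attractingZero_neg (F : OQF) : attractingZero (-F.1, -F.2) = attractingZero F := by
  unfold attractingZero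
  rcases Int.units_eq_one_or F.2 with h | h <;>
    simp [h, QF.zeroPlus_neg, QF.zeroMinus_neg]

theorem repellingZero_neg (F : OQF) : repellingZero (-F.1, -F.2) = repellingZero F := by
  unfold repellingZero
  rcases Int.units_eq_one_or F.2 with h | h <;>
    simp [h, QF.zeroPlus_neg, QF.zeroMinus_neg]

theorem toSL_neg (F : OQF) : toSL (-F.1, -F.2) = -toSL F := by
  apply Subtype.ext
  rw [Matrix.SpecialLinearGroup.coe_neg]
  simp only [toSL, QF.neg_a, QF.neg_b, QF.neg_c, QF.discr_neg]
  ext i j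
  fin_cases i <;> fin_cases j <;> simp <;> ring

/-- `g` and `-g` define the same element of `PSL(2, ℝ)`. -/
theorem mk_neg (g : SL(2, ℝ)) : ((-g : SL(2, ℝ)) : PSL(2, ℝ)) = (g : PSL(2, ℝ)) := by
  rw [QuotientGroup.eq]
  have h : (-g)⁻¹ * g = -1 := by
    rw [inv_mul_eq_iff_eq_mul]
    simp
  rw [h, Subgroup.mem_center_iff]
  intro x
  simp

end OQF

/-- Projective oriented quadratic forms `[f, s] = {(f, s), (-f, -s)}`. -/
def POQF : Type := Quotient OQF.setoid

namespace POQF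

/-- The discriminant of `[f, s]` is that of `f`. -/
def discr : POQF → ℝ :=
  Quotient.lift (fun F : OQF => F.1.discr) (by
    rintro F G (rfl | rfl)
    · rfl
    · exact QF.discr_neg _)

/-- The attracting zero of `[f, s]`. -/
def attractingZero : POQF → WithTop ℝ :=
  Quotient.lift OQF.attractingZero (by
    rintro F G (rfl | rfl)
    · rfl
    · exact OQF.attractingZero_neg G)

/-- The repelling zero of `[f, s]`. -/
def repellingZero : POQF → WithTop ℝ :=
  Quotient.lift OQF.repellingZero (by
    rintro F G (rfl | rfl)
    · rfl
    · exact OQF.repellingZero_neg G)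

/-- The element of `PSL(2, ℝ)` attached to `[f, s]`. -/
def toPSL : POQF → PSL(2, ℝ) :=
  Quotient.lift (fun F : OQF => ((OQF.toSL F : SL(2, ℝ)) : PSL(2, ℝ))) (by
    rintro F G (rfl | rfl)
    · rfl
    · show ((OQF.toSL (-G.1, -G.2) : SL(2, ℝ)) : PSL(2, ℝ)) = _
      rw [OQF.toSL_neg, OQF.mk_neg])

/-- A projective oriented form is reduced if its attracting zero is positive and its repelling
zero is negative. -/
def IsReduced (F : POQF) : Prop := 0 < F.attractingZero ∧ F.repellingZero < 0

end POQF

/-- The cusp width `λ_q = 2 cos(π / q)`. -/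
def cuspWidth (q : ℕ) : ℝ := 2 * Real.cos (Real.pi / q)

/-- The generator `S = (0, 1; -1, 0)`. -/
def genS : SL(2, ℝ) := ⟨!![0, 1; -1, 0], by simp [Matrix.det_fin_two_of]⟩

/-- The generator `T_q = (1, λ_q; 0, 1)`. -/
def genT (q : ℕ) : SL(2, ℝ) := ⟨!![1, cuspWidth q; 0, 1], by simp [Matrix.det_fin_two_of]⟩

/-- The Hecke triangle group `Γ_q`, the subgroup of `PSL(2, ℝ)` generated by `S` and `T_q`. -/
def heckeGroup (q : ℕ) : Subgroup PSL(2, ℝ) :=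
  Subgroup.closure {(genS : PSL(2, ℝ)), (genT q : PSL(2, ℝ))}

/-- An element of `PSL(2, ℝ)` is hyperbolic if the matrices representing it are. -/
def IsHyperbolic (g : PSL(2, ℝ)) : Prop :=
  ∃ A : SL(2, ℝ), (A : PSL(2, ℝ)) = g ∧ (A : Matrix (Fin 2) (Fin 2) ℝ).IsHyperbolic

/-- The `Γ_q`-forms: the projective oriented forms whose associated element of `PSL(2, ℝ)` is a
hyperbolic element of `Γ_q`. -/
def heckeForms (q : ℕ) : Set POQF :=
  {F | F.toPSL ∈ heckeGroup q ∧ IsHyperbolic F.toPSL}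

end HeckeForms

end

/-!
Let `U = T S⁻¹`, which satisfies `U ^ q = -1`, and put `V k = U ^ k T` for `0 ≤ k ≤ q - 2`. With
`σ k = sin (k π / q) / sin (π / q)` one has `V k = (σ (k + 1), σ (k + 2); σ k, σ (k + 1))`, and
`1 ≤ σ k` for `1 ≤ k ≤ q - 1` while `σ 0 = σ q = 0`. So all entries of `V k` lie in
`{0} ∪ [1, ∞)`, a set closed under addition and multiplication, and hence so do all entries of all
products of the `V k`.

Since `S` and `U` generate the Hecke group and `U * V k = V (k + 1)`, `U * V (q - 2) = S ^ 3`, every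
element of the group lifts to `S ^ i * P * S ^ j` with `P` a product of matrices `V k`
(`mem_words_of_mem_closure`). Multiplication by `S` permutes the entries up to sign. This has two
consequences, which together replace the discreteness of the group.

* Every entry of an element of the group is zero or at least `1` in absolute value
  (`hasGap_of_mem_closure`).
* Only finitely many elements have bounded entries (`finite_entrySum_le`), because every factor `V k`
  raises the sum of the entries of a product by at least `1`.

For a reduced form `[a, b, c, s]` of discriminant at most `D` in the group, `a = 0` would make the
matrix triangular with diagonal entries at least `1` in absolute value and product `1`, so that the
discriminant, which is the squared trace minus `4`, would vanish. Thus `a ≠ 0`, and the zeros have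
opposite signs, so `a c < 0`. Now `|a|, |c| ≥ 1` and `b ^ 2 + 4 |a c| ≤ D` bound all the entries.
-/

open scoped MatrixGroups

noncomputable section

namespace HeckeForms

/-! ### The matrices `V k` -/

/-- The ratio `sin (k π / q) / sin (π / q)`. -/
def sinRatio (q k : ℕ) : ℝ := Real.sin (k * (Real.pi / q)) / Real.sin (Real.pi / q)

/-- The lift `T S⁻¹ = (λ, -1; 1, 0)` of the elliptic generator of order `q`. -/
def genU (q : ℕ) : SL(2, ℝ) := genT q * genS ^ 3

/-- The matrix `U ^ k T`; only the indices `k ≤ q - 2` are used as letters of words. -/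
def genV (q k : ℕ) : SL(2, ℝ) := genU q ^ k * genT q

section sinRatio

variable {q : ℕ}

theorem sin_pi_div_pos (hq : 3 ≤ q) : 0 < Real.sin (Real.pi / q) := by
  have h : (3 : ℝ) ≤ q := by exact_mod_cast hq
  refine Real.sin_pos_of_pos_of_lt_pi (by have := Real.pi_pos; positivity) ?_
  rw [div_lt_iff₀ (by linarith)]
  nlinarith [Real.pi_pos]

theorem sinRatio_zero : sinRatio q 0 = 0 := by simp [sinRatio]

theorem sinRatio_one (hq : 3 ≤ q) : sinRatio q 1 = 1 := by
  simp [sinRatio, (sin_pi_div_pos hq).ne']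

theorem sinRatio_add_two (k : ℕ) :
    sinRatio q (k + 2) = cuspWidth q * sinRatio q (k + 1) - sinRatio q k := by
  have h : Real.sin ((k + 2 : ℕ) * (Real.pi / q)) = cuspWidth q *
      Real.sin ((k + 1 : ℕ) * (Real.pi / q)) - Real.sin (k * (Real.pi / q)) := by
    have e1 : ((k + 2 : ℕ) : ℝ) * (Real.pi / q) =
      ((k + 1 : ℕ) : ℝ) * (Real.pi / q) + Real.pi / q := by push_cast; ring
    have e2 : (k : ℝ) * (Real.pi / q) =
      ((k + 1 : ℕ) : ℝ) * (Real.pi / q) - Real.pi / q := by push_cast; ring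
    rw [e1, e2, Real.sin_add, Real.sin_sub, cuspWidth]
    ring
  simp only [sinRatio, h]
  ring

theorem sinRatio_self (hq : 3 ≤ q) : sinRatio q q = 0 := by
  have h : (q : ℝ) ≠ 0 := by positivity
  simp [sinRatio, mul_div_cancel₀ _ h]

theorem one_le_sinRatio (hq : 3 ≤ q) {k : ℕ} (h1 : 1 ≤ k) (h2 : k + 1 ≤ q) :
    1 ≤ sinRatio q k := by
  have hq0 : (0 : ℝ) < q := by positivity
  have hpi := Real.pi_pos
  have hθ : 0 < Real.pi / q := by positivity
  have hk1 : (1 : ℝ) ≤ k := by exact_mod_cast h1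
  have hk2 : (k : ℝ) + 1 ≤ q := by exact_mod_cast h2
  have hle : ((k : ℝ) + 1) * (Real.pi / q) ≤ Real.pi := by
    calc ((k : ℝ) + 1) * (Real.pi / q) ≤ q * (Real.pi / q) := by gcongr
      _ = Real.pi := by field_simp
  rw [sinRatio, one_le_div (sin_pi_div_pos hq), ← sub_nonneg, Real.sin_sub_sin]
  -- Both half-angles `(k ∓ 1) π / (2 q)` lie in `[0, π / 2]`.
  have hs : 0 ≤ Real.sin ((k * (Real.pi / q) - Real.pi / q) / 2) :=
    Real.sin_nonneg_of_nonneg_of_le_pi (by nlinarith) (by nlinarith)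
  have hc : 0 ≤ Real.cos ((k * (Real.pi / q) + Real.pi / q) / 2) :=
    Real.cos_nonneg_of_neg_pi_div_two_le_of_le (by nlinarith) (by nlinarith)
  positivity

end sinRatio

theorem coe_genS : (genS : Matrix (Fin 2) (Fin 2) ℝ) = !![0, 1; -1, 0] := rfl

theorem coe_genT (q : ℕ) : (genT q : Matrix (Fin 2) (Fin 2) ℝ) = !![1, cuspWidth q; 0, 1] := rfl

theorem genS_sq : genS ^ 2 = -1 := by
  ext i j
  rw [pow_two, Matrix.SpecialLinearGroup.coe_mul, coe_genS]
  fin_cases i <;> fin_cases j <;> simp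

theorem genS_pow_three : genS ^ 3 = -genS := by
  rw [pow_succ, genS_sq, neg_mul, one_mul]

theorem genS_pow_four : genS ^ 4 = 1 := by
  rw [show 4 = 2 * 2 from rfl, pow_mul, genS_sq]
  simp

theorem coe_genU (q : ℕ) : (genU q : Matrix (Fin 2) (Fin 2) ℝ) = !![cuspWidth q, -1; 1, 0] := by
  rw [genU, genS_pow_three, Matrix.SpecialLinearGroup.coe_mul, Matrix.SpecialLinearGroup.coe_neg,
    coe_genS, coe_genT]
  ext i j
  fin_cases i <;> fin_cases j <;> simp

theorem genU_mul_genS (q : ℕ) : genU q * genS = genT q := by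
  rw [genU, mul_assoc, ← pow_succ, genS_pow_four, mul_one]

theorem genU_mul_genV (q k : ℕ) : genU q * genV q k = genV q (k + 1) := by
  rw [genV, genV, pow_succ', mul_assoc]

theorem coe_genV {q : ℕ} (hq : 3 ≤ q) (k : ℕ) : (genV q k : Matrix (Fin 2) (Fin 2) ℝ) =
    !![sinRatio q (k + 1), sinRatio q (k + 2); sinRatio q k, sinRatio q (k + 1)] := by
  induction k with
  | zero =>
    have h := sinRatio_add_two (q := q) 0
    simp only [zero_add] at h
    rw [genV, pow_zero, one_mul, coe_genT]
    simp [h, sinRatio_zero, sinRatio_one hq]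
  | succ k ih =>
    rw [← genU_mul_genV, Matrix.SpecialLinearGroup.coe_mul, ih, coe_genU,
      sinRatio_add_two (k + 1), sinRatio_add_two k]
    ext i j
    fin_cases i <;> fin_cases j <;> simp <;> ring

/-- This is the relation `U ^ q = -1` in terms of the `V k`: since `T = U S`, one has
`U ^ (q - 1) T = U ^ q S = -S`. -/
theorem genV_pred {q : ℕ} (hq : 3 ≤ q) : genV q (q - 1) = genS ^ 3 := by
  obtain ⟨m, rfl⟩ : ∃ m, q = m + 1 := ⟨q - 1, by omega⟩
  have h1 : sinRatio (m + 1) (m + 1) = 0 := sinRatio_self hq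
  have hm : sinRatio (m + 1) m = 1 := by
    have h : (((m + 1 : ℕ) : ℝ)) ≠ 0 := by positivity
    have e : (m : ℝ) * (Real.pi / (m + 1 : ℕ)) = Real.pi - Real.pi / (m + 1 : ℕ) := by
      field_simp
      push_cast
      ring
    rw [sinRatio, e, Real.sin_pi_sub, div_self (sin_pi_div_pos hq).ne']
  have h2 : sinRatio (m + 1) (m + 2) = -1 := by
    rw [sinRatio_add_two, h1, hm]
    ring
  apply Subtype.ext
  rw [Nat.add_sub_cancel, coe_genV hq, h1, h2, hm, genS_pow_three,
    Matrix.SpecialLinearGroup.coe_neg, coe_genS]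
  ext i j
  fin_cases i <;> fin_cases j <;> simp

/-! ### Words in the matrices `V k` -/

/-- The product of the matrices `V k` over a list of indices `0 ≤ k ≤ q - 2`. -/
def wordProd {q : ℕ} (l : List (Fin (q - 1))) : SL(2, ℝ) :=
  (l.map fun k : Fin (q - 1) => genV q k).prod

/-- The matrices `S ^ i * P * S ^ j` with `P` a product of matrices `V k`. -/
def words (q : ℕ) : Set SL(2, ℝ) :=
  {g | ∃ (i j : ℕ) (l : List (Fin (q - 1))), g = genS ^ i * wordProd l * genS ^ j}

theorem wordProd_cons {q : ℕ} (k : Fin (q - 1)) (l : List (Fin (q - 1))) :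
    wordProd (k :: l) = genV q k * wordProd l := by
  simp [wordProd]

theorem genS_mul_mem_words {q : ℕ} {g : SL(2, ℝ)} (hg : g ∈ words q) : genS * g ∈ words q := by
  obtain ⟨i, j, l, rfl⟩ := hg
  exact ⟨i + 1, j, l, by rw [pow_succ', mul_assoc, mul_assoc, mul_assoc]⟩

theorem genS_pow_mul_mem_words {q : ℕ} {g : SL(2, ℝ)} (n : ℕ) (hg : g ∈ words q) :
    genS ^ n * g ∈ words q := by
  induction n with
  | zero => simpa using hg
  | succ n ih =>
    rw [pow_succ', mul_assoc]
    exact genS_mul_mem_words ih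

theorem genU_mul_wordProd_mem {q : ℕ} (hq : 3 ≤ q) (l : List (Fin (q - 1))) (j : ℕ) :
    genU q * (wordProd l * genS ^ j) ∈ words q := by
  cases l with
  | nil =>
    refine ⟨0, j + 3, [⟨0, by omega⟩], ?_⟩
    -- `U = T S ^ 3`, and `T = V 0`.
    simp only [wordProd, genV, genU, List.map_nil, List.prod_nil, List.map_cons, List.prod_cons,
      pow_zero, one_mul, mul_one]
    rw [mul_assoc, ← pow_add, add_comm]
  | cons k l =>
    rw [wordProd_cons, mul_assoc, ← mul_assoc, genU_mul_genV]
    by_cases hk : (k : ℕ) + 1 < q - 1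
    · refine ⟨0, j, ⟨k + 1, hk⟩ :: l, ?_⟩
      rw [wordProd_cons, pow_zero, one_mul, mul_assoc]
    · have hk' : (k : ℕ) + 1 = q - 1 := by have := k.2; omega
      rw [hk', genV_pred hq]
      exact ⟨3, j, l, by rw [mul_assoc]⟩

theorem genU_mul_mem_words {q : ℕ} (hq : 3 ≤ q) {g : SL(2, ℝ)} (hg : g ∈ words q) :
    genU q * g ∈ words q := by
  obtain ⟨i, j, l, rfl⟩ := hg
  -- The central factor `S ^ (2 m) = (-1) ^ m` is moved past `U`.
  have hcomm : ∀ m : ℕ, Commute (genU q) (genS ^ (2 * m)) := fun m => by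
    rw [pow_mul, genS_sq]
    exact ((Commute.one_right _).neg_right).pow_right m
  rcases Nat.even_or_odd' i with ⟨m, rfl | rfl⟩
  · have h := genS_pow_mul_mem_words (2 * m) (genU_mul_wordProd_mem hq l j)
    rwa [← mul_assoc, ← (hcomm m).eq, mul_assoc, ← mul_assoc (genS ^ (2 * m))] at h
  · have h : genU q * (genS ^ (2 * m + 1) * wordProd l * genS ^ j) =
        genS ^ (2 * m) * (genU q * genS * (wordProd l * genS ^ j)) := by
      rw [pow_succ]
      simp only [← mul_assoc]
      rw [(hcomm m).eq]
    rw [h, genU_mul_genS]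
    refine genS_pow_mul_mem_words _ ⟨0, j, ⟨0, by omega⟩ :: l, ?_⟩
    simp [wordProd_cons, genV, mul_assoc]

theorem genU_pow_mul_mem_words {q : ℕ} (hq : 3 ≤ q) {g : SL(2, ℝ)} (n : ℕ) (hg : g ∈ words q) :
    genU q ^ n * g ∈ words q := by
  induction n with
  | zero => simpa using hg
  | succ n ih =>
    rw [pow_succ', mul_assoc]
    exact genU_mul_mem_words hq ih

theorem inv_genS : genS⁻¹ = genS ^ 3 := by
  rw [inv_eq_iff_mul_eq_one, ← pow_succ', genS_pow_four]

theorem inv_genT {q : ℕ} (hq : 3 ≤ q) : (genT q)⁻¹ = genS * genU q ^ (q - 1) := by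
  have h := genV_pred hq
  rw [genV] at h
  exact inv_eq_of_mul_eq_one_left (by rw [mul_assoc, h, ← pow_succ', genS_pow_four])

theorem mem_words_of_mem_closure {q : ℕ} (hq : 3 ≤ q) {g : SL(2, ℝ)}
    (hg : g ∈ Subgroup.closure {genS, genT q}) : g ∈ words q := by
  induction hg using Subgroup.closure_induction_left with
  | one => exact ⟨0, 0, [], by simp [wordProd]⟩
  | mul_left x hx y _ ih =>
    rcases hx with rfl | rfl
    · exact genS_mul_mem_words ih
    · rw [← genU_mul_genS, mul_assoc]
      exact genU_mul_mem_words hq (genS_mul_mem_words ih)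
  | inv_mul_cancel x hx y _ ih =>
    rcases hx with rfl | rfl
    · rw [inv_genS]
      exact genS_pow_mul_mem_words 3 ih
    · rw [inv_genT hq, mul_assoc]
      exact genS_mul_mem_words (genU_pow_mul_mem_words hq _ ih)

/-! ### Entries of the elements of the Hecke group -/

/-- Every entry of `g` is zero or at least `1` in absolute value. -/
def HasGap (g : SL(2, ℝ)) : Prop := ∀ i j, g i j = 0 ∨ 1 ≤ |g i j|

/-- The sum of the absolute values of the entries of `g`. -/
def entrySum (g : SL(2, ℝ)) : ℝ := ∑ i, ∑ j, |g i j|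

/-- The diagonal entries of `g` are at least `1`, the other two are zero or at least `1`. These
matrices form a monoid. -/
structure IsLarge (g : SL(2, ℝ)) : Prop where
  zero_zero : 1 ≤ g 0 0
  one_one : 1 ≤ g 1 1
  zero_one : g 0 1 = 0 ∨ 1 ≤ g 0 1
  one_zero : g 1 0 = 0 ∨ 1 ≤ g 1 0

theorem IsLarge.zero_one_nonneg {g : SL(2, ℝ)} (hg : IsLarge g) : 0 ≤ g 0 1 := by
  rcases hg.zero_one with h | h <;> linarith

theorem IsLarge.one_zero_nonneg {g : SL(2, ℝ)} (hg : IsLarge g) : 0 ≤ g 1 0 := by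
  rcases hg.one_zero with h | h <;> linarith

theorem IsLarge.one : IsLarge 1 := ⟨by simp, by simp, by simp, by simp⟩

theorem SL_mul_apply (g h : SL(2, ℝ)) (i j : Fin 2) :
    (g * h) i j = g i 0 * h 0 j + g i 1 * h 1 j := by
  simp [Matrix.mul_apply, Fin.sum_univ_two]

theorem eq_zero_or_one_le_mul_add_mul {x y z w : ℝ} (hx : 1 ≤ x) (hy : y = 0 ∨ 1 ≤ y)
    (hz : z = 0 ∨ 1 ≤ z) (hw : 1 ≤ w) : x * y + z * w = 0 ∨ 1 ≤ x * y + z * w := by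
  rcases hy with rfl | hy <;> rcases hz with rfl | hz
  · left; ring
  · right; nlinarith
  · right; nlinarith
  · right; nlinarith

theorem IsLarge.mul {g h : SL(2, ℝ)} (hg : IsLarge g) (hh : IsLarge h) : IsLarge (g * h) := by
  refine ⟨?_, ?_, ?_, ?_⟩ <;> rw [SL_mul_apply]
  · nlinarith [hg.zero_zero, hh.zero_zero, mul_nonneg hg.zero_one_nonneg hh.one_zero_nonneg]
  · nlinarith [hg.one_one, hh.one_one, mul_nonneg hg.one_zero_nonneg hh.zero_one_nonneg]
  · exact eq_zero_or_one_le_mul_add_mul hg.zero_zero hh.zero_one hg.zero_one hh.one_one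
  · rw [add_comm]
    exact eq_zero_or_one_le_mul_add_mul hg.one_one hh.one_zero hg.one_zero hh.zero_zero

theorem IsLarge.hasGap {g : SL(2, ℝ)} (hg : IsLarge g) : HasGap g := by
  obtain ⟨h00, h11, h01, h10⟩ := hg
  intro i j
  fin_cases i <;> fin_cases j
  · exact Or.inr (h00.trans (le_abs_self _))
  · exact h01.imp_right fun h => h.trans (le_abs_self _)
  · exact h10.imp_right fun h => h.trans (le_abs_self _)
  · exact Or.inr (h11.trans (le_abs_self _))

theorem isLarge_genV {q : ℕ} (hq : 3 ≤ q) (k : Fin (q - 1)) : IsLarge (genV q k) := by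
  have hk := k.2
  have hd : 1 ≤ sinRatio q (k + 1) := one_le_sinRatio hq (by omega) (by omega)
  refine ⟨?_, ?_, ?_, ?_⟩ <;> rw [coe_genV hq]
  · simpa using hd
  · simpa using hd
  · rcases (show (k : ℕ) + 2 = q ∨ (k : ℕ) + 3 ≤ q by omega) with h | h
    · left; simp [h, sinRatio_self hq]
    · right; simpa using one_le_sinRatio hq (by omega) h
  · rcases Nat.eq_zero_or_pos (k : ℕ) with h | h
    · left; simp [h, sinRatio_zero]
    · right; simpa using one_le_sinRatio hq h (by omega)

theorem isLarge_wordProd {q : ℕ} (hq : 3 ≤ q) (l : List (Fin (q - 1))) :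
    IsLarge (wordProd l) := by
  induction l with
  | nil => simpa [wordProd] using IsLarge.one
  | cons k l ih =>
    rw [wordProd_cons]
    exact (isLarge_genV hq k).mul ih

theorem IsLarge.entrySum_eq {g : SL(2, ℝ)} (hg : IsLarge g) :
    entrySum g = g 0 0 + g 0 1 + (g 1 0 + g 1 1) := by
  simp only [entrySum, Fin.sum_univ_two]
  rw [abs_of_nonneg (zero_le_one.trans hg.zero_zero), abs_of_nonneg hg.zero_one_nonneg,
    abs_of_nonneg hg.one_zero_nonneg, abs_of_nonneg (zero_le_one.trans hg.one_one)]

/-- An off-diagonal entry of `V k` is at least `1` because `σ k` and `σ (k + 2)` vanish only for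
`k = 0` and `k = q - 2` respectively, and `q ≥ 3`. -/
theorem one_le_offDiag_genV {q : ℕ} (hq : 3 ≤ q) (k : Fin (q - 1)) :
    1 ≤ genV q k 0 1 ∨ 1 ≤ genV q k 1 0 := by
  have hk := k.2
  rw [coe_genV hq]
  rcases Nat.eq_zero_or_pos (k : ℕ) with h | h
  · left; simpa using one_le_sinRatio (k := k + 2) hq (by omega) (by omega)
  · right; simpa using one_le_sinRatio hq h (by omega)

theorem entrySum_genV_mul {q : ℕ} (hq : 3 ≤ q) (k : Fin (q - 1)) {g : SL(2, ℝ)}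
    (hg : IsLarge g) : entrySum g + 1 ≤ entrySum (genV q k * g) := by
  have hv := isLarge_genV hq k
  have h := one_le_offDiag_genV hq k
  rw [(hv.mul hg).entrySum_eq, hg.entrySum_eq]
  simp only [SL_mul_apply]
  have v00 := hv.zero_zero
  have v11 := hv.one_one
  have v01 := hv.zero_one_nonneg
  have v10 := hv.one_zero_nonneg
  have hr0 : 1 ≤ g 0 0 + g 0 1 := by linarith [hg.zero_zero, hg.zero_one_nonneg]
  have hr1 : 1 ≤ g 1 0 + g 1 1 := by linarith [hg.one_one, hg.one_zero_nonneg]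
  generalize genV q k = v at *
  have a0 := mul_le_mul_of_nonneg_right v00 (zero_le_one.trans hr0)
  have a1 := mul_le_mul_of_nonneg_right v11 (zero_le_one.trans hr1)
  have a2 := mul_le_mul_of_nonneg_left hr1 v01
  have a3 := mul_le_mul_of_nonneg_left hr0 v10
  rcases h with h | h <;> linarith

/-- The length of a word is bounded by the entries of its product, so there are only finitely many
products with bounded entries. -/
theorem length_le_entrySum_wordProd {q : ℕ} (hq : 3 ≤ q) (l : List (Fin (q - 1))) :
    (l.length : ℝ) ≤ entrySum (wordProd l) := by
  induction l with
  | nil =>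
    rw [List.length_nil, Nat.cast_zero]
    exact Finset.sum_nonneg fun i _ => Finset.sum_nonneg fun j _ => abs_nonneg _
  | cons k l ih =>
    rw [wordProd_cons, List.length_cons]
    push_cast
    linarith [entrySum_genV_mul hq k (isLarge_wordProd hq l)]

theorem genS_mul_apply_zero (g : SL(2, ℝ)) (j : Fin 2) : (genS * g) 0 j = g 1 j := by
  simp [SL_mul_apply, coe_genS]

theorem genS_mul_apply_one (g : SL(2, ℝ)) (j : Fin 2) : (genS * g) 1 j = -g 0 j := by
  simp [SL_mul_apply, coe_genS]

theorem mul_genS_apply_zero (g : SL(2, ℝ)) (i : Fin 2) : (g * genS) i 0 = -g i 1 := by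
  simp [SL_mul_apply, coe_genS]

theorem mul_genS_apply_one (g : SL(2, ℝ)) (i : Fin 2) : (g * genS) i 1 = g i 0 := by
  simp [SL_mul_apply, coe_genS]

theorem HasGap.genS_mul {g : SL(2, ℝ)} (hg : HasGap g) : HasGap (genS * g) := by
  intro i j
  fin_cases i
  · simpa only [Fin.zero_eta, genS_mul_apply_zero] using hg 1 j
  · simpa only [Fin.mk_one, genS_mul_apply_one, neg_eq_zero, abs_neg] using hg 0 j

theorem HasGap.mul_genS {g : SL(2, ℝ)} (hg : HasGap g) : HasGap (g * genS) := by
  intro i j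
  fin_cases j
  · simpa only [Fin.zero_eta, mul_genS_apply_zero, neg_eq_zero, abs_neg] using hg i 1
  · simpa only [Fin.mk_one, mul_genS_apply_one] using hg i 0

theorem HasGap.genS_pow_mul_mul {g : SL(2, ℝ)} (hg : HasGap g) (i j : ℕ) :
    HasGap (genS ^ i * g * genS ^ j) := by
  induction j with
  | zero =>
    induction i with
    | zero => simpa using hg
    | succ i ih => simpa [pow_succ', mul_assoc] using ih.genS_mul
  | succ j ih => simpa [pow_succ, mul_assoc] using ih.mul_genS

theorem entrySum_genS_mul (g : SL(2, ℝ)) : entrySum (genS * g) = entrySum g := by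
  simp only [entrySum, Fin.sum_univ_two, genS_mul_apply_zero, genS_mul_apply_one, abs_neg]
  ring

theorem entrySum_mul_genS (g : SL(2, ℝ)) : entrySum (g * genS) = entrySum g := by
  simp only [entrySum, Fin.sum_univ_two, mul_genS_apply_zero, mul_genS_apply_one, abs_neg]
  ring

theorem entrySum_genS_pow_mul_mul (g : SL(2, ℝ)) (i j : ℕ) :
    entrySum (genS ^ i * g * genS ^ j) = entrySum g := by
  induction j with
  | zero =>
    induction i with
    | zero => simp
    | succ i ih =>
      rw [← ih, ← entrySum_genS_mul (genS ^ i * g * genS ^ 0), pow_succ']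
      simp [mul_assoc]
  | succ j ih =>
    rw [← ih, ← entrySum_mul_genS (genS ^ i * g * genS ^ j), pow_succ]
    simp [mul_assoc]

theorem hasGap_of_mem_closure {q : ℕ} (hq : 3 ≤ q) {g : SL(2, ℝ)}
    (hg : g ∈ Subgroup.closure {genS, genT q}) : HasGap g := by
  obtain ⟨i, j, l, rfl⟩ := mem_words_of_mem_closure hq hg
  exact (isLarge_wordProd hq l).hasGap.genS_pow_mul_mul i j

theorem finite_entrySum_le {q : ℕ} (hq : 3 ≤ q) (N : ℝ) :
    {g : SL(2, ℝ) | g ∈ Subgroup.closure {genS, genT q} ∧ entrySum g ≤ N}.Finite := by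
  have hS : (Submonoid.powers genS : Set SL(2, ℝ)).Finite :=
    (isOfFinOrder_iff_pow_eq_one.mpr ⟨4, by norm_num, genS_pow_four⟩).finite_powers
  have hL := List.finite_length_le (Fin (q - 1)) ⌊N⌋₊
  refine ((hS.prod (hL.prod hS)).image fun x => x.1 * wordProd x.2.1 * x.2.2).subset ?_
  rintro g ⟨hg, hN⟩
  obtain ⟨i, j, l, rfl⟩ := mem_words_of_mem_closure hq hg
  rw [entrySum_genS_pow_mul_mul] at hN
  exact ⟨(genS ^ i, l, genS ^ j), ⟨⟨i, rfl⟩, Nat.le_floor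
    ((length_le_entrySum_wordProd hq l).trans hN), ⟨j, rfl⟩⟩, rfl⟩

/-- The subgroup of `SL(2, ℝ)` generated by `S` and `T` is the full preimage of the Hecke group, as
it contains `-1 = S ^ 2`. -/
theorem mem_closure_of_coe_mem_heckeGroup {q : ℕ} {g : SL(2, ℝ)}
    (hg : (g : PSL(2, ℝ)) ∈ heckeGroup q) : g ∈ Subgroup.closure {genS, genT q} := by
  have hmap : heckeGroup q = (Subgroup.closure {genS, genT q}).map
      (QuotientGroup.mk' (Subgroup.center SL(2, ℝ))) := by
    rw [MonoidHom.map_closure, Set.image_pair]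
    rfl
  rw [hmap] at hg
  obtain ⟨h, hh, e⟩ := hg
  have hc : h⁻¹ * g ∈ Subgroup.center SL(2, ℝ) := QuotientGroup.eq.mp e
  obtain ⟨r, hr, hrg⟩ := Matrix.SpecialLinearGroup.mem_center_iff.mp hc
  have hneg : (-1 : SL(2, ℝ)) ∈ Subgroup.closure {genS, genT q} := by
    rw [← genS_sq]
    exact pow_mem (Subgroup.subset_closure (by simp)) 2
  have hz : h⁻¹ * g ∈ Subgroup.closure {genS, genT q} := by
    have hr' : r = 1 ∨ r = -1 := by simpa using hr
    rcases hr' with rfl | rfl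
    · have : h⁻¹ * g = 1 := by
        apply Subtype.ext
        rw [← hrg]
        simp
      rw [this]
      exact one_mem _
    · have : h⁻¹ * g = -1 := by
        apply Subtype.ext
        rw [← hrg, map_neg, map_one]
        simp
      rw [this]
      exact hneg
  simpa using mul_mem hh hz

/-! ### Reduced forms -/

theorem OQF.coe_toSL (F : OQF) : (F.toSL : Matrix (Fin 2) (Fin 2) ℝ) =
    !![(-F.1.b + ((F.2 : ℤ) : ℝ) * √(F.1.discr + 4)) / 2, -F.1.c;
      F.1.a, (F.1.b + ((F.2 : ℤ) : ℝ) * √(F.1.discr + 4)) / 2] := rfl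

theorem OQF.sqrt_discr_add_four_pos (F : OQF) : 0 < √(F.1.discr + 4) := by
  have h : 0 < F.1.discr := F.1.discr_pos
  positivity

theorem OQF.toSL_injective : Function.Injective OQF.toSL := by
  rintro ⟨f, s⟩ ⟨g, t⟩ h
  have h' := congrArg (fun x : SL(2, ℝ) => (x : Matrix (Fin 2) (Fin 2) ℝ)) h
  simp only [coe_toSL] at h'
  have e00 := congrFun₂ h' 0 0
  have e01 := congrFun₂ h' 0 1
  have e10 := congrFun₂ h' 1 0
  have e11 := congrFun₂ h' 1 1
  simp at e00 e01 e10 e11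
  have hfg : f = g := QF.ext e10 (by linarith) e01
  subst hfg
  have hr := (OQF.sqrt_discr_add_four_pos (f, s)).ne'
  have hst : ((s : ℤ) : ℝ) = ((t : ℤ) : ℝ) := mul_right_cancel₀ hr (by linarith)
  rw [Prod.mk.injEq]
  exact ⟨rfl, Units.ext (by exact_mod_cast hst)⟩

theorem QF.mul_neg_of_zeros {f : QF} (ha : f.a ≠ 0)
    (h : (0 < f.zeroPlus ∧ f.zeroMinus < 0) ∨ (0 < f.zeroMinus ∧ f.zeroPlus < 0)) :
    f.a * f.c < 0 := by
  have hd := Real.mul_self_sqrt (show 0 ≤ f.discr from f.discr_pos.le)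
  have hprod : (-f.b + √f.discr) / (2 * f.a) * ((-f.b - √f.discr) / (2 * f.a)) =
      f.a * f.c / f.a ^ 2 := by
    have hdd : f.discr = f.b ^ 2 - 4 * f.a * f.c := rfl
    field_simp
    linear_combination -hd - hdd
  simp only [zeroPlus, zeroMinus, ha, if_false, ← WithTop.coe_zero, WithTop.coe_lt_coe] at h
  have hneg : f.a * f.c / f.a ^ 2 < 0 := by
    rw [← hprod]
    rcases h with h | h
    · exact mul_neg_of_pos_of_neg h.1 h.2
    · exact mul_neg_of_neg_of_pos h.2 h.1
  have hpos : 0 < f.a ^ 2 := by positivity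
  rwa [div_lt_iff₀ hpos, zero_mul] at hneg

/-- If `a` vanished, the diagonal entries of the matrix would be at least `1` in absolute value with
product `1`, hence equal; but their difference is `b`, which is nonzero along with the discriminant. -/
theorem OQF.a_ne_zero_of_hasGap {F : OQF} (h : HasGap F.toSL) : F.1.a ≠ 0 := by
  intro ha
  have hb := F.1.b_ne_zero_of_a_eq_zero ha
  have hdet := F.toSL.det_coe
  have h0 := h 0 0
  have h1 := h 1 1
  rw [coe_toSL] at hdet h0 h1
  rw [Matrix.det_fin_two_of, ha, mul_zero, sub_zero] at hdet
  simp only [Matrix.of_apply, Matrix.cons_val', Matrix.cons_val_zero, Matrix.cons_val_one,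
    Matrix.cons_val_fin_one] at h0 h1
  set x := (-F.1.b + ((F.2 : ℤ) : ℝ) * √(F.1.discr + 4)) / 2 with hx
  set y := (F.1.b + ((F.2 : ℤ) : ℝ) * √(F.1.discr + 4)) / 2 with hy
  have hx0 : x ≠ 0 := left_ne_zero_of_mul_eq_one hdet
  have hy0 : y ≠ 0 := right_ne_zero_of_mul_eq_one hdet
  have hx1 : 1 ≤ |x| := h0.resolve_left hx0
  have hy1 : 1 ≤ |y| := h1.resolve_left hy0
  have hxy : |x| * |y| = 1 := by rw [← abs_mul, hdet, abs_one]
  have hx2 : x ^ 2 = 1 := by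
    rw [← sq_abs, show |x| = 1 by nlinarith]
    norm_num
  have hyx : y = x := by
    have h2 : x * (y - x) = 0 := by linear_combination hdet - hx2
    exact sub_eq_zero.mp ((mul_eq_zero.mp h2).resolve_left hx0)
  exact hb (by linarith)

theorem OQF.entrySum_toSL_le {F : OQF} {D : ℝ} (h : HasGap F.toSL) (hac : F.1.a * F.1.c < 0)
    (hD : F.1.discr ≤ D) : entrySum F.toSL ≤ 4 * (D + 5) := by
  have h0 := h 0 1
  have h1 := h 1 0
  have hpos : 0 < F.1.discr := F.1.discr_pos
  simp only [entrySum, Fin.sum_univ_two]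
  rw [coe_toSL] at h0 h1 ⊢
  simp only [Matrix.of_apply, Matrix.cons_val', Matrix.cons_val_zero, Matrix.cons_val_one,
    Matrix.cons_val_fin_one, abs_neg, neg_eq_zero] at h0 h1 ⊢
  have hc : 1 ≤ |F.1.c| := h0.resolve_left (right_ne_zero_of_mul hac.ne)
  have ha : 1 ≤ |F.1.a| := h1.resolve_left (left_ne_zero_of_mul hac.ne)
  have habs : |F.1.a| * |F.1.c| = -(F.1.a * F.1.c) := by rw [← abs_mul, abs_of_neg hac]
  have hdd : F.1.discr = F.1.b ^ 2 - 4 * F.1.a * F.1.c := rfl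
  have hsum : F.1.b ^ 2 + 4 * (|F.1.a| * |F.1.c|) ≤ D := by rw [habs]; linarith
  have hb2 := sq_nonneg F.1.b
  have ha' : |F.1.a| ≤ D := by nlinarith
  have hc' : |F.1.c| ≤ D := by nlinarith
  have hb' : -(D + 1) ≤ F.1.b ∧ F.1.b ≤ D + 1 := abs_le_of_sq_le_sq' (by nlinarith) (by linarith)
  have hr : ((F.2 : ℤ) : ℝ) * √(F.1.discr + 4) ≤ D + 5 ∧
      -(D + 5) ≤ ((F.2 : ℤ) : ℝ) * √(F.1.discr + 4) := by
    have hr0 := F.sqrt_discr_add_four_pos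
    have hr1 : √(F.1.discr + 4) ≤ D + 5 :=
      Real.sqrt_le_iff.mpr ⟨by linarith, by nlinarith⟩
    rcases Int.units_eq_one_or F.2 with e | e <;> rw [e] <;> simp <;> constructor <;> linarith
  obtain ⟨hb1, hb3⟩ := hb'
  have hx : |(-F.1.b + ((F.2 : ℤ) : ℝ) * √(F.1.discr + 4)) / 2| ≤ D + 5 :=
    abs_le.mpr ⟨by linarith, by linarith⟩
  have hy : |(F.1.b + ((F.2 : ℤ) : ℝ) * √(F.1.discr + 4)) / 2| ≤ D + 5 :=
    abs_le.mpr ⟨by linarith, by linarith⟩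
  linarith

end HeckeForms

end

theorem mainTheorem2 (q : ℕ) (hq : 3 ≤ q) (D : ℝ) (hD : 0 < D) :
    {F : HeckeForms.POQF | F ∈ HeckeForms.heckeForms q ∧ F.IsReduced ∧ F.discr ≤ D}.Finite := by
  refine (((HeckeForms.finite_entrySum_le hq (4 * (D + 5))).preimage
    HeckeForms.OQF.toSL_injective.injOn).image (Quotient.mk HeckeForms.OQF.setoid)).subset ?_
  rintro F ⟨⟨hF, -⟩, hred, hdisc⟩
  induction F using Quotient.inductionOn with
  | h F =>
    have hmem := HeckeForms.mem_closure_of_coe_mem_heckeGroup (g := HeckeForms.OQF.toSL F) hF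
    have hgap := HeckeForms.hasGap_of_mem_closure hq hmem
    have ha := HeckeForms.OQF.a_ne_zero_of_hasGap hgap
    refine ⟨F, ⟨hmem, HeckeForms.OQF.entrySum_toSL_le hgap
      (HeckeForms.QF.mul_neg_of_zeros ha ?_) hdisc⟩, rfl⟩
    have hred' : 0 < HeckeForms.OQF.attractingZero F ∧ HeckeForms.OQF.repellingZero F < 0 := hred
    unfold HeckeForms.OQF.attractingZero HeckeForms.OQF.repellingZero at hred'
    by_cases hs : F.2 = 1
    · exact Or.inl (by simpa [hs] using hred')
    · exact Or.inr (by simpa [hs] using hred')
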